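/- Let $\Omega\subseteq\mathbb R^2$ be measurable, $\lambda\ge 0$ an integrable density on $\Omega$ with $\int_\Omega\lambda=1$, $p_1,\dots,p_K\in\mathbb R^2$ ($K\ge 1$), $d_i(x)=|x-p_i|$ the Euclidean distance, and $F:[0,\infty)\to\mathbb R$ continuous such that $F(d_i)\,\lambda$ is integrable on $\Omega$ for every $i$ (automatic if $\Omega$ is bounded). Let $s_1,\dots,s_K:[0,1]\to\mathbb R$ be continuously differentiable, non-decreasing and convex. A cell partition of $\Omega$ is a family $(C_1,\dots,C_K)$ of measurable sets with $\bigcup_i C_i=\Omega$ and $\int_{C_i\cap C_j}\lambda=0$ for $i\ne j$; write $N_i=\int_{C_i}\lambda$. Consider the problem $$\mathrm{(P1)}\qquad \min_{(C_i)\text{ cell partition of }\Omega}\ \sum_{i=1}^K\int_{C_i}\bigl[F(d_i(x))+s_i(N_i)\bigr]\lambda(x)\,dx .$$ (a) (P1) has a solution $(C_i)$ with pairwise disjoint cells such that, for $L_i(x)=F(d_i(x))+s_i(N_i)+N_i\,s_i'(N_i)$ and every $i$, $$\{x\in\Omega: L_i(x)<L_j(x)\ \forall j\ne i\}\ \subseteq\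 C_i\ \subseteq\ \{x\in\Omega: L_i(x)\le L_j(x)\ \forall j\}.$$ That is, $C_i$ is the set of points where $L_i$ is minimal over all indices, points where several indices are minimal being assigned to one of these indices. (b) If moreover the points $p_i$ are distinct and every level set $\{r\ge 0: F(r)=c\}$, $c\in\mathbb R$, has Lebesgue measure zero (for example, if $F$ is strictly monotone), then (P1) has a solution $(C_i)$ that satisfies $$\mathrm{(S1)}\qquad C_i=\{x\in\Omega: F(d_i(x))+s_i(N_i)+N_i\,s_i'(N_i)\le F(d_j(x))+s_j(N_j)+N_j\,s_j'(N_j)\ \forall j\},\qquad N_i=\int_{C_i}\lambda,$$ for every $i$. -/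

import Mathlib

open MeasureTheory Set

namespace CellAssociation

/-- The Euclidean plane. -/
abbrev Plane : Type := EuclideanSpace ℝ (Fin 2)

/-- The mass `∬_A lam` of a region `A` under the density `lam`. -/
noncomputable def mass (lam : Plane → ℝ) (A : Set Plane) : ℝ :=
  ∫ x in A, lam x

/-- `C` is a cell partition of `Ω`: measurable cells that cover `Ω` exactly and whose pairwise
overlaps carry no mass (cells given by non-strict inequalities share their boundaries). -/
structure IsCellPartition {K : ℕ} (Ω : Set Plane) (lam : Plane → ℝ)
    (C : Fin K → Set Plane) : Prop where
  measurable : ∀ i, MeasurableSet (C i)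
  cover : ⋃ i, C i = Ω
  overlap : ∀ i j, i ≠ j → mass lam (C i ∩ C j) = 0

/-- The objective of (P1), with base stations at the points `p i`:
`∑ i, ∬_{C i} [F (d_i) + s_i (N_i)] lam`, where `N_i` is the mass of `C i`. -/
noncomputable def cost {K : ℕ} (p : Fin K → Plane) (lam : Plane → ℝ) (F : ℝ → ℝ)
    (s : Fin K → ℝ → ℝ) (C : Fin K → Set Plane) : ℝ :=
  ∑ i, ∫ x in C i, (F (dist x (p i)) + s i (mass lam (C i))) * lam x

/-- `C` solves (P1): it is a cell partition of least cost among all cell partitions of `Ω`. -/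
def SolvesP1 {K : ℕ} (Ω : Set Plane) (p : Fin K → Plane) (lam : Plane → ℝ) (F : ℝ → ℝ)
    (s : Fin K → ℝ → ℝ) (C : Fin K → Set Plane) : Prop :=
  IsCellPartition Ω lam C ∧
    ∀ D : Fin K → Set Plane, IsCellPartition Ω lam D → cost p lam F s C ≤ cost p lam F s D

/-- `F (d_i x) + s_i (N_i) + N_i * s_i' (N_i)`; the derivative is that of `s_i` as a function on
`[0, 1]`, so one-sided at the end points. -/
noncomputable def level {K : ℕ} (p : Fin K → Plane) (F : ℝ → ℝ) (s : Fin K → ℝ → ℝ)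
    (N : Fin K → ℝ) (i : Fin K) (x : Plane) : ℝ :=
  F (dist x (p i)) + s i (N i) + N i * derivWithin (s i) (Icc 0 1) (N i)

/-- The points of `Ω` at which the level of index `i` is minimal among all indices. -/
def minCell {K : ℕ} (Ω : Set Plane) (p : Fin K → Plane) (F : ℝ → ℝ) (s : Fin K → ℝ → ℝ)
    (N : Fin K → ℝ) (i : Fin K) : Set Plane :=
  {x | x ∈ Ω ∧ ∀ j, level p F s N i x ≤ level p F s N j x}

/-- The points of `Ω` at which the level of index `i` is the only minimal one. -/
def strictMinCell {K : ℕ} (Ω : Set Plane) (p : Fin K → Plane) (F : ℝ → ℝ) (s : Fin K → ℝ → ℝ)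
    (N : Fin K → ℝ) (i : Fin K) : Set Plane :=
  {x | x ∈ Ω ∧ ∀ j, j ≠ i → level p F s N i x < level p F s N j x}

end CellAssociation

/-!
Replace a partition by weights in the dual of `L¹`, i.e. by families of positive functionals that
sum to integration. They form a weak-* compact set on which the cost is continuous, so a minimiser
exists. Minimality along segments says that the minimiser also minimises the linearised cost, in
which index `i` pays `F (d_i) + s_i (N_i) + N_i * s_i' (N_i)`; hence each weight lives where its own
level is minimal. The population has no atoms, so on each of the finitely many regions where the
set of minimal indices is constant the weights can be replaced by a genuine partition with the same
masses. As `t * s_i t` lies above its tangents, any partition into minimal cells of its own masses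
is optimal.

For the equality of sets, two minimal cells meet only where `F (d_i)` and `F (d_j)` differ by a
constant. Away from the line through two stations the pair of distances is a local diffeomorphism,
and the pairs of radii at which `F` differs by a constant are null by Fubini.
-/

namespace CellAssociation

open Filter Topology

section FractionalPartitions

variable {X ι : Type*} [MeasurableSpace X] [Fintype ι] {μ : Measure X}

/-- Fractional partitions of a measure `μ` among the indices `i`: families of weights `w i ≥ 0`
with `∑ i, w i = 1`, encoded by the functionals `g ↦ ∫ g * w i ∂μ` on `L¹(μ)`. The weak-*
topology makes them a compact convex set, in which the a.e. partitions are the weights with values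
in `{0, 1}`. -/
def fractionalPartitions (μ : Measure X) (ι : Type*) [Fintype ι] :
    Set (ι → WeakDual ℝ (X →₁[μ] ℝ)) :=
  {Λ | (∀ i g, 0 ≤ g → 0 ≤ Λ i g) ∧ ∀ g, ∑ i, Λ i g = ∫ x, g x ∂μ}

variable {Λ : ι → WeakDual ℝ (X →₁[μ] ℝ)}

lemma convex_fractionalPartitions : Convex ℝ (fractionalPartitions μ ι) := by
  rintro Λ ⟨hΛ, hΛ'⟩ Λ' ⟨hM, hM'⟩ a b ha hb hab
  refine ⟨fun i g hg => add_nonneg (mul_nonneg ha (hΛ i g hg)) (mul_nonneg hb (hM i g hg)),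
    fun g => ?_⟩
  calc ∑ i, (a • Λ + b • Λ') i g = a * ∑ i, Λ i g + b * ∑ i, Λ' i g := by
        rw [Finset.mul_sum, Finset.mul_sum, ← Finset.sum_add_distrib]
        rfl
    _ = ∫ x, g x ∂μ := by rw [hΛ', hM', ← add_mul, hab, one_mul]

lemma monotone_of_mem_fractionalPartitions (hΛ : Λ ∈ fractionalPartitions μ ι) (i : ι) :
    Monotone (Λ i) := fun g h hgh => by
  simpa only [map_sub, sub_nonneg] using hΛ.1 i (h - g) (sub_nonneg.2 hgh)

lemma le_integral_of_mem_fractionalPartitions (hΛ : Λ ∈ fractionalPartitions μ ι) (i : ι)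
    {g : X →₁[μ] ℝ} (hg : 0 ≤ g) : Λ i g ≤ ∫ x, g x ∂μ :=
  hΛ.2 g ▸ Finset.single_le_sum (fun j _ => hΛ.1 j g hg) (Finset.mem_univ i)

lemma norm_le_one_of_mem_fractionalPartitions (hΛ : Λ ∈ fractionalPartitions μ ι) (i : ι) :
    ‖WeakDual.toStrongDual (Λ i)‖ ≤ 1 := by
  refine ContinuousLinearMap.opNorm_le_bound _ zero_le_one fun g => ?_
  have hmono := monotone_of_mem_fractionalPartitions hΛ i
  calc |Λ i g| ≤ Λ i |g| :=
        abs_le.2 ⟨neg_le.1 (map_neg (Λ i) g ▸ hmono (neg_le_abs g)), hmono (le_abs_self g)⟩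
    _ ≤ ∫ x, |g| x ∂μ := le_integral_of_mem_fractionalPartitions hΛ i (abs_nonneg g)
    _ = 1 * ‖g‖ := by
        rw [one_mul, L1.norm_eq_integral_norm]
        exact integral_congr_ae (Lp.coeFn_abs g)

lemma isClosed_fractionalPartitions : IsClosed (fractionalPartitions μ ι) := by
  have heval (i : ι) (g : X →₁[μ] ℝ) :
      Continuous fun Λ : ι → WeakDual ℝ (X →₁[μ] ℝ) => Λ i g :=
    (WeakDual.eval_continuous g).comp (continuous_apply i)
  simp only [fractionalPartitions, ofPred_and, ofPred_forall]
  refine .inter ?_ ?_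
  · exact isClosed_iInter fun i => isClosed_iInter fun g => isClosed_iInter fun _ =>
      isClosed_le continuous_const (heval i g)
  · exact isClosed_iInter fun g =>
      isClosed_eq (continuous_finsetSum _ fun i _ => heval i g) continuous_const

lemma isCompact_fractionalPartitions : IsCompact (fractionalPartitions μ ι) :=
  (isCompact_univ_pi fun _ => WeakDual.isCompact_closedBall (𝕜 := ℝ) 0 1).of_isClosed_subset
    isClosed_fractionalPartitions fun Λ hΛ i _ =>
      (mem_closedBall_zero_iff (a := WeakDual.toStrongDual (Λ i))).2
        (norm_le_one_of_mem_fractionalPartitions hΛ i)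

end FractionalPartitions

section Indicators

variable {X : Type*} [MeasurableSpace X] {μ : Measure X} [IsFiniteMeasure μ] {E : Set X}

/-- The indicator function of a measurable set, as an element of `L¹` of a finite measure. -/
noncomputable def indicatorL1 (μ : Measure X) [IsFiniteMeasure μ] {E : Set X}
    (hE : MeasurableSet E) : X →₁[μ] ℝ :=
  indicatorConstLp 1 hE (measure_ne_top μ E) 1

lemma indicatorL1_coeFn (hE : MeasurableSet E) : indicatorL1 μ hE =ᵐ[μ] E.indicator fun _ => 1 :=
  indicatorConstLp_coeFn

lemma indicatorL1_nonneg (hE : MeasurableSet E) : 0 ≤ indicatorL1 μ hE := by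
  refine (Lp.coeFn_nonneg _).1 ?_
  filter_upwards [indicatorL1_coeFn (μ := μ) hE] with x hx
  exact hx ▸ indicator_nonneg (fun _ _ => zero_le_one) x

lemma integral_indicatorL1 (hE : MeasurableSet E) : ∫ x, indicatorL1 μ hE x ∂μ = μ.real E := by
  rw [integral_congr_ae (indicatorL1_coeFn hE), integral_indicator_const _ hE, smul_eq_mul,
    mul_one]

lemma sum_indicatorL1_fiber {β : Type*} [Fintype β] {τ : X → β}
    (hτ : ∀ b, MeasurableSet (τ ⁻¹' {b})) :
    ∑ b, indicatorL1 μ (hτ b) = indicatorL1 μ MeasurableSet.univ := by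
  classical
  refine Lp.ext ?_
  filter_upwards [Lp.coeFn_finsetSum Finset.univ fun b => indicatorL1 μ (hτ b),
    ae_all_iff.2 fun b => indicatorL1_coeFn (μ := μ) (hτ b),
    indicatorL1_coeFn (μ := μ) MeasurableSet.univ] with x hsum hx huniv
  rw [hsum, huniv, Finset.sum_apply, indicator_univ]
  simp [hx, indicator_apply]

lemma toL1_add_const {f : X → ℝ} (hf : Integrable f μ) (c : ℝ) :
    Integrable.toL1 (fun x => f x + c) (hf.add (integrable_const c))
      = hf.toL1 f + c • indicatorL1 μ MeasurableSet.univ := by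
  refine (Integrable.toL1_add _ _ hf (integrable_const c)).trans (congrArg _ ?_)
  refine Lp.ext ?_
  filter_upwards [(integrable_const (μ := μ) c).coeFn_toL1, Lp.coeFn_smul c (indicatorL1 μ
    MeasurableSet.univ), indicatorL1_coeFn (μ := μ) MeasurableSet.univ] with x hc hsmul hx
  rw [hc, hsmul, Pi.smul_apply, hx, indicator_univ, smul_eq_mul, mul_one]

lemma tendsto_indicatorL1_iUnion {A : ℕ → Set X} (hA : ∀ n, MeasurableSet (A n))
    (hA_mono : Monotone A) :
    Tendsto (fun n => indicatorL1 μ (hA n)) atTop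
      (𝓝 (indicatorL1 μ (MeasurableSet.iUnion hA))) := by
  refine tendsto_indicatorConstLp_set ENNReal.one_ne_top ?_
  simp only [symmDiff_of_le (subset_iUnion A _)]
  have h := tendsto_measure_iInter_atTop (μ := μ) (s := fun n => (⋃ m, A m) \ A n)
    (fun n => ((MeasurableSet.iUnion hA).diff (hA n)).nullMeasurableSet)
    (fun m n hmn => sdiff_subset_sdiff_right (hA_mono hmn)) ⟨0, measure_ne_top _ _⟩
  rwa [← sdiff_iUnion, sdiff_self, measure_empty] at h

end Indicators

section RelaxedProblem

variable {X ι : Type*} [MeasurableSpace X] [Fintype ι] {μ : Measure X} [IsFiniteMeasure μ]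
  {Λ Λ' : ι → WeakDual ℝ (X →₁[μ] ℝ)}

lemma sum_apply_indicatorL1 (hΛ : Λ ∈ fractionalPartitions μ ι) {E : Set X}
    (hE : MeasurableSet E) : ∑ i, Λ i (indicatorL1 μ hE) = μ.real E := by
  rw [hΛ.2, integral_indicatorL1]

lemma apply_indicatorL1_univ_mem_Icc (hΛ : Λ ∈ fractionalPartitions μ ι) (i : ι) :
    Λ i (indicatorL1 μ MeasurableSet.univ) ∈ Icc 0 (μ.real univ) :=
  ⟨hΛ.1 i _ (indicatorL1_nonneg _), integral_indicatorL1 (μ := μ) MeasurableSet.univ ▸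
    le_integral_of_mem_fractionalPartitions hΛ i (indicatorL1_nonneg _)⟩

/-- Complementary slackness. -/
lemma apply_indicatorL1_eq_zero_of_pos
    (hΛ : Λ ∈ fractionalPartitions μ ι) {i : ι} {h : X → ℝ} (hmeas : Measurable h)
    (hint : Integrable h μ) (hnonneg : 0 ≤ h) (hzero : Λ i (hint.toL1 h) = 0) {E : Set X}
    (hE : MeasurableSet E) (hpos : ∀ x ∈ E, 0 < h x) : Λ i (indicatorL1 μ hE) = 0 := by
  set A : ℕ → Set X := fun n => E ∩ {x | 1 ≤ n * h x}
  have hA (n : ℕ) : MeasurableSet (A n) :=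
    hE.inter (measurableSet_le measurable_const (hmeas.const_mul (n : ℝ)))
  have hA_mono : Monotone A := fun m n hmn x hx =>
    ⟨hx.1, hx.2.trans (mul_le_mul_of_nonneg_right (Nat.cast_le.2 hmn) (hnonneg x))⟩
  have hA_iUnion : ⋃ n, A n = E := by
    refine (iUnion_subset fun n => inter_subset_left).antisymm fun x hx => mem_iUnion.2 ?_
    obtain ⟨n, hn⟩ := exists_nat_ge (h x)⁻¹
    exact ⟨n, hx, (inv_le_iff_one_le_mul₀ (hpos x hx)).1 hn⟩
  have hzero_A (n : ℕ) : Λ i (indicatorL1 μ (hA n)) = 0 := by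
    refine (hΛ.1 i _ (indicatorL1_nonneg (hA n))).antisymm' ?_
    calc Λ i (indicatorL1 μ (hA n)) ≤ Λ i ((n : ℝ) • hint.toL1 h) := by
          refine monotone_of_mem_fractionalPartitions hΛ i ((Lp.coeFn_le _ _).1 ?_)
          filter_upwards [indicatorL1_coeFn (μ := μ) (hA n), Lp.coeFn_smul (n : ℝ) (hint.toL1 h),
            hint.coeFn_toL1] with x hx_ind hx_smul hx
          rw [hx_ind, hx_smul, Pi.smul_apply, hx, smul_eq_mul]
          exact indicator_apply_le' (fun hxA => hxA.2)
            fun _ => mul_nonneg n.cast_nonneg (hnonneg x)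
      _ = 0 := by rw [map_smul, hzero, smul_zero]
  have hlim := ((Λ i).continuous.tendsto _).comp (tendsto_indicatorL1_iUnion (μ := μ) hA hA_mono)
  simp only [hA_iUnion] at hlim
  exact tendsto_nhds_unique hlim (tendsto_const_nhds.congr fun n => (hzero_A n).symm)

/-- The cost of a fractional partition: the weight of index `i` pays `f i` per unit of mass and a
charge `G i` that depends on its total mass. -/
noncomputable def relaxedCost (f : ι → X →₁[μ] ℝ) (G : ι → ℝ → ℝ)
    (Λ : ι → WeakDual ℝ (X →₁[μ] ℝ)) : ℝ :=
  ∑ i, (Λ i (f i) + G i (Λ i (indicatorL1 μ MeasurableSet.univ)))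

variable {f : ι → X →₁[μ] ℝ} {G : ι → ℝ → ℝ}

lemma continuousOn_relaxedCost (hG : ∀ i, ContinuousOn (G i) (Icc 0 (μ.real univ))) :
    ContinuousOn (relaxedCost f G) (fractionalPartitions μ ι) := by
  have heval (i : ι) (g : X →₁[μ] ℝ) :
      Continuous fun Λ : ι → WeakDual ℝ (X →₁[μ] ℝ) => Λ i g :=
    (WeakDual.eval_continuous g).comp (continuous_apply i)
  exact continuousOn_finsetSum _ fun i _ => (heval i _).continuousOn.add <|
    (hG i).comp (heval i _).continuousOn fun Λ hΛ => apply_indicatorL1_univ_mem_Icc hΛ i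

/-- First-order condition, from the derivative along the segments issuing from the minimizer. -/
lemma isMinOn_linearization_of_isMinOn_relaxedCost (hΛ : Λ ∈ fractionalPartitions μ ι)
    (hmin : IsMinOn (relaxedCost f G) (fractionalPartitions μ ι) Λ) {v : ι → ℝ}
    (hv : ∀ i, HasDerivWithinAt (G i) (v i) (Icc 0 (μ.real univ))
      (Λ i (indicatorL1 μ MeasurableSet.univ))) :
    IsMinOn (fun Λ => ∑ i, Λ i (f i + v i • indicatorL1 μ MeasurableSet.univ))
      (fractionalPartitions μ ι) Λ := by
  intro Λ' hΛ'
  set u := indicatorL1 μ (MeasurableSet.univ (α := X))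
  have hline (t : ℝ) (i : ι) (g : X →₁[μ] ℝ) :
      AffineMap.lineMap Λ Λ' t i g = AffineMap.lineMap (Λ i g) (Λ' i g) t := by
    simp only [AffineMap.lineMap_apply_module]; rfl
  have hmem {t : ℝ} (ht : t ∈ Icc (0 : ℝ) 1) :
      AffineMap.lineMap Λ Λ' t ∈ fractionalPartitions μ ι :=
    convex_fractionalPartitions.lineMap_mem hΛ hΛ' ht
  have hmin_line : IsMinOn (fun t : ℝ => relaxedCost f G (AffineMap.lineMap Λ Λ' t))
    (Icc (0 : ℝ) 1) 0 :=
    fun t ht => by simpa using hmin (hmem ht)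
  have hderiv : HasDerivWithinAt (fun t : ℝ => relaxedCost f G (AffineMap.lineMap Λ Λ' t))
      (∑ i, ((Λ' i (f i) - Λ i (f i)) + v i * (Λ' i u - Λ i u))) (Icc 0 1) 0 := by
    simp only [relaxedCost, hline]
    refine HasDerivWithinAt.fun_sum fun i _ => AffineMap.hasDerivWithinAt_lineMap.add ?_
    have hGi : HasDerivWithinAt (G i) (v i) (Icc 0 (μ.real univ))
        (AffineMap.lineMap (Λ i u) (Λ' i u) (0 : ℝ)) := by simpa using hv i
    exact hGi.comp 0 AffineMap.hasDerivWithinAt_lineMap fun t ht =>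
      hline t i u ▸ apply_indicatorL1_univ_mem_Icc (hmem ht) i
  have hnonneg := hmin_line.localize.hasFDerivWithinAt_nonneg hderiv.hasFDerivWithinAt
    (y := 1) (mem_posTangentConeAt_of_segment_subset (by simp [segment_eq_Icc]))
  rw [ContinuousLinearMap.toSpanSingleton_apply, one_smul] at hnonneg
  refine sub_nonneg.1 (hnonneg.trans_eq ?_)
  rw [← Finset.sum_sub_distrib]
  refine Finset.sum_congr rfl fun i _ => ?_
  rw [map_add, map_add, map_smul, map_smul, smul_eq_mul, smul_eq_mul]
  ring

lemma isMinOn_relaxedCost_of_isMinOn_linearization {v : ι → ℝ}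
    (hmin : IsMinOn (fun Λ => ∑ i, Λ i (f i + v i • indicatorL1 μ MeasurableSet.univ))
      (fractionalPartitions μ ι) Λ)
    (hv : ∀ i, ∀ t ∈ Icc 0 (μ.real univ),
      G i (Λ i (indicatorL1 μ MeasurableSet.univ))
        + v i * (t - Λ i (indicatorL1 μ MeasurableSet.univ)) ≤ G i t) :
    IsMinOn (relaxedCost f G) (fractionalPartitions μ ι) Λ := by
  intro Λ' hΛ'
  have hlin := hmin hΛ'
  have htangent := Finset.sum_le_sum fun i (_ : i ∈ Finset.univ) =>
    hv i _ (apply_indicatorL1_univ_mem_Icc hΛ' i)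
  simp only [mem_ofPred_eq, relaxedCost, map_add, map_smul, smul_eq_mul, mul_sub,
    Finset.sum_add_distrib, Finset.sum_sub_distrib] at hlin htangent ⊢
  linarith

end RelaxedProblem

section Partitions

variable {X ι : Type*} [MeasurableSpace X] {μ : Measure X}

/-- Measurable sets that cover the space and are pairwise disjoint, both up to null sets. -/
structure IsAEPartition (μ : Measure X) (A : ι → Set X) : Prop where
  measurableSet : ∀ i, MeasurableSet (A i)
  aedisjoint : Pairwise (Function.onFun (AEDisjoint μ) A)
  iUnion_ae_eq_univ : ⋃ i, A i =ᵐ[μ] univ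

variable {A : ι → Set X}

lemma IsAEPartition.sum_setIntegral [Fintype ι] (hA : IsAEPartition μ A) {g : X → ℝ}
    (hg : Integrable g μ) :
    ∑ i, ∫ x in A i, g x ∂μ = ∫ x, g x ∂μ := by
  rw [← setIntegral_univ, ← setIntegral_congr_set hA.iUnion_ae_eq_univ,
    integral_iUnion_ae (fun i => (hA.measurableSet i).nullMeasurableSet) hA.aedisjoint
      hg.integrableOn, tsum_fintype]

lemma isAEPartition_fiber [MeasurableSpace ι] [MeasurableSingletonClass ι] {σ : X → ι}
    (hσ : Measurable σ) : IsAEPartition μ fun i => σ ⁻¹' {i} where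
  measurableSet i := hσ (measurableSet_singleton i)
  aedisjoint _ _ hij := ((disjoint_singleton.2 hij).preimage σ).aedisjoint
  iUnion_ae_eq_univ := by rw [← preimage_iUnion, iUnion_of_singleton, preimage_univ]; rfl

/-- Integration over a set, as a functional on `L¹`. -/
noncomputable def setIntegralFunctional (μ : Measure X) (E : Set X) : WeakDual ℝ (X →₁[μ] ℝ) :=
  StrongDual.toWeakDual ((L1.integralCLM' ℝ).comp (LpToLpRestrictCLM X ℝ ℝ μ 1 E))

lemma setIntegralFunctional_apply (E : Set X) (g : X →₁[μ] ℝ) :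
    setIntegralFunctional μ E g = ∫ x in E, g x ∂μ := by
  change L1.integralCLM' ℝ (LpToLpRestrictCLM X ℝ ℝ μ 1 E g) = _
  rw [← integral_congr_ae (LpToLpRestrictCLM_coeFn ℝ E g), ← L1.integral_eq_integral,
    L1.integral_def]
  rfl

lemma setIntegralFunctional_toL1 (E : Set X) {g : X → ℝ} (hg : Integrable g μ) :
    setIntegralFunctional μ E (hg.toL1 g) = ∫ x in E, g x ∂μ := by
  rw [setIntegralFunctional_apply]
  exact integral_congr_ae (ae_restrict_of_ae hg.coeFn_toL1)

lemma setIntegralFunctional_indicatorL1_univ [IsFiniteMeasure μ] {E : Set X} :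
    setIntegralFunctional μ E (indicatorL1 μ MeasurableSet.univ) = μ.real E := by
  rw [setIntegralFunctional_apply,
    integral_congr_ae (ae_restrict_of_ae (indicatorL1_coeFn MeasurableSet.univ))]
  simp

lemma IsAEPartition.setIntegralFunctional_mem [Fintype ι] (hA : IsAEPartition μ A) :
    (fun i => setIntegralFunctional μ (A i)) ∈ fractionalPartitions μ ι := by
  refine ⟨fun i g hg => ?_, fun g => ?_⟩
  · rw [setIntegralFunctional_apply]
    exact integral_nonneg_of_ae (ae_restrict_of_ae ((Lp.coeFn_nonneg g).2 hg))
  · simp only [setIntegralFunctional_apply, hA.sum_setIntegral (L1.integrable_coeFn g)]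

lemma nonempty_fractionalPartitions [Fintype ι] [Nonempty ι] :
    (fractionalPartitions μ ι).Nonempty :=
  let _ : MeasurableSpace ι := ⊤
  ⟨_, (isAEPartition_fiber
    (measurable_const (a := Classical.arbitrary ι))).setIntegralFunctional_mem⟩

lemma ae_eq_of_subset_of_aedisjoint [Countable ι] {B : ι → Set X} (hAB : ∀ i, A i ⊆ B i)
    (hB : Pairwise (Function.onFun (AEDisjoint μ) B)) (hcover : ⋃ i, B i ⊆ ⋃ i, A i) (i : ι) :
    A i =ᵐ[μ] B i := by
  refine (LE.le.eventuallyLE (hAB i)).antisymm (ae_le_set.2 ?_)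
  refine measure_mono_null (t := ⋃ j, ⋃ _ : i ≠ j, B i ∩ B j) ?_
    (measure_iUnion_null fun j => measure_iUnion_null fun hij => hB hij)
  rintro x ⟨hxB, hxA⟩
  obtain ⟨j, hj⟩ := mem_iUnion.1 (hcover (mem_iUnion_of_mem i hxB))
  exact mem_iUnion₂.2 ⟨j, fun hij => hxA (hij ▸ hj), hxB, hAB j hj⟩

end Partitions

section Gluing

variable {X ι β : Type*} [MeasurableSpace X] [MeasurableSpace ι] {A : X → β}
  {τ : β → X → ι}

lemma measurable_glue [Countable β] (hA : ∀ b, MeasurableSet (A ⁻¹' {b}))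
    (hτ : ∀ b, Measurable (τ b)) : Measurable fun x => τ (A x) x := fun s hs => by
  have hpreimage : (fun x => τ (A x) x) ⁻¹' s = ⋃ b, A ⁻¹' {b} ∩ τ b ⁻¹' s := by ext; simp
  exact hpreimage ▸ .iUnion fun b => (hA b).inter (hτ b hs)

lemma measureReal_glue_preimage [Fintype β] {μ : Measure X} [IsFiniteMeasure μ]
    (hA : ∀ b, MeasurableSet (A ⁻¹' {b})) (hτ : ∀ b, Measurable (τ b)) {s : Set ι}
    (hs : MeasurableSet s) :
    μ.real ((fun x => τ (A x) x) ⁻¹' s) = ∑ b, μ.real (A ⁻¹' {b} ∩ τ b ⁻¹' s) := by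
  have hpreimage : (fun x => τ (A x) x) ⁻¹' s = ⋃ b, A ⁻¹' {b} ∩ τ b ⁻¹' s := by ext; simp
  rw [hpreimage, measureReal_iUnion_fintype (fun b c hbc => ?_) fun b => (hA b).inter (hτ b hs)]
  exact ((disjoint_singleton.2 hbc).preimage A).mono inter_subset_left inter_subset_left

end Gluing

section Argmin

variable {X ι : Type*} [Fintype ι]

/-- The set of indices at which `a` is minimal. -/
noncomputable def argminSet (a : ι → ℝ) : Finset ι :=
  open scoped Classical in Finset.univ.filter fun i => ∀ j, a i ≤ a j

lemma mem_argminSet {a : ι → ℝ} {i : ι} : i ∈ argminSet a ↔ ∀ j, a i ≤ a j := by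
  simp [argminSet]

lemma argminSet_nonempty [Nonempty ι] (a : ι → ℝ) : (argminSet a).Nonempty :=
  (Finite.exists_min a).imp fun _ h => mem_argminSet.2 h

lemma ciInf_eq_iff_mem_argminSet {a : ι → ℝ} {i : ι} : ⨅ j, a j = a i ↔ i ∈ argminSet a := by
  have : Nonempty ι := ⟨i⟩
  rw [mem_argminSet]
  exact ⟨fun h j => h ▸ ciInf_le (finite_range a).bddBelow j,
    fun h => le_antisymm (ciInf_le (finite_range a).bddBelow i) (le_ciInf h)⟩

variable [MeasurableSpace X] {L : ι → X → ℝ}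

lemma measurableSet_argminSet_fiber (hL : ∀ i, Measurable (L i)) (S : Finset ι) :
    MeasurableSet ((fun x => argminSet fun i => L i x) ⁻¹' {S}) := by
  have hmem (i : ι) : MeasurableSet {x | i ∈ argminSet fun j => L j x} := by
    simp only [mem_argminSet, ofPred_forall]
    exact .iInter fun j => measurableSet_le (hL i) (hL j)
  simp only [preimage, mem_singleton_iff, Finset.ext_iff, ofPred_forall]
  exact .iInter fun i => by
    by_cases hi : i ∈ S <;> simp only [hi, iff_true, iff_false]
    exacts [hmem i, (hmem i).compl]

lemma exists_measurable_argmin [Nonempty ι] [MeasurableSpace ι] (hL : ∀ i, Measurable (L i)) :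
    ∃ σ : X → ι, Measurable σ ∧ ∀ x, σ x ∈ argminSet fun i => L i x := by
  classical
  have hchoice (S : Finset ι) : ∃ i, S.Nonempty → i ∈ S := by
    by_cases hS : S.Nonempty
    exacts [hS.imp fun _ hi _ => hi, ⟨Classical.arbitrary ι, fun h => absurd h hS⟩]
  choose c hc using hchoice
  exact ⟨fun x => c (argminSet fun i => L i x),
    measurable_glue (τ := fun S _ => c S) (measurableSet_argminSet_fiber hL)
      fun _ => measurable_const, fun x => hc _ (argminSet_nonempty _)⟩

end Argmin

section LowerEnvelope

variable {X ι : Type*} [MeasurableSpace X] [Nonempty ι] {μ : Measure X} {L : ι → X → ℝ}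

lemma integrable_iInf [Finite ι] (hL : ∀ i, Measurable (L i)) (hLi : ∀ i, Integrable (L i) μ) :
    Integrable (fun x => ⨅ i, L i x) μ := by
  cases nonempty_fintype ι
  refine (integrable_finsetSum Finset.univ fun i _ => (hLi i).norm).mono'
    (Measurable.iInf hL).aestronglyMeasurable (Eventually.of_forall fun x => ?_)
  obtain ⟨i, hmin⟩ := argminSet_nonempty fun i => L i x
  rw [ciInf_eq_iff_mem_argminSet.2 hmin]
  exact Finset.single_le_sum (f := fun i => ‖L i x‖) (fun _ _ => norm_nonneg _) (Finset.mem_univ i)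

variable [Fintype ι]

lemma sum_apply_toL1_iInf (hL : ∀ i, Measurable (L i)) (hLi : ∀ i, Integrable (L i) μ)
    {Λ : ι → WeakDual ℝ (X →₁[μ] ℝ)} (hΛ : Λ ∈ fractionalPartitions μ ι) :
    ∑ i, Λ i ((integrable_iInf hL hLi).toL1 _) = ∫ x, ⨅ i, L i x ∂μ := by
  rw [hΛ.2]
  exact integral_congr_ae (integrable_iInf hL hLi).coeFn_toL1

lemma apply_toL1_iInf_le (hL : ∀ i, Measurable (L i)) (hLi : ∀ i, Integrable (L i) μ)
    {Λ : ι → WeakDual ℝ (X →₁[μ] ℝ)} (hΛ : Λ ∈ fractionalPartitions μ ι) (i : ι) :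
    Λ i ((integrable_iInf hL hLi).toL1 _) ≤ Λ i ((hLi i).toL1 (L i)) := by
  refine monotone_of_mem_fractionalPartitions hΛ i ((Lp.coeFn_le _ _).1 ?_)
  filter_upwards [(integrable_iInf hL hLi).coeFn_toL1, (hLi i).coeFn_toL1] with x hx hxi
  exact hx ▸ hxi ▸ ciInf_le (finite_range fun j => L j x).bddBelow i

lemma IsAEPartition.sum_setIntegral_eq_integral_iInf {A : ι → Set X} (hA : IsAEPartition μ A)
    (hL : ∀ i, Measurable (L i)) (hLi : ∀ i, Integrable (L i) μ)
    (hmin : ∀ i, ∀ x ∈ A i, i ∈ argminSet fun j => L j x) :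
    ∑ i, ∫ x in A i, L i x ∂μ = ∫ x, ⨅ i, L i x ∂μ := by
  rw [← hA.sum_setIntegral (integrable_iInf hL hLi)]
  exact Finset.sum_congr rfl fun i _ => setIntegral_congr_fun (hA.measurableSet i) fun x hx =>
    (ciInf_eq_iff_mem_argminSet.2 (hmin i x hx)).symm

lemma IsAEPartition.isMinOn_sum_apply_toL1 {A : ι → Set X} (hA : IsAEPartition μ A)
    (hL : ∀ i, Measurable (L i)) (hLi : ∀ i, Integrable (L i) μ)
    (hmin : ∀ i, ∀ x ∈ A i, i ∈ argminSet fun j => L j x) :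
    IsMinOn (fun Λ => ∑ i, Λ i ((hLi i).toL1 (L i))) (fractionalPartitions μ ι)
      fun i => setIntegralFunctional μ (A i) := fun Λ hΛ => by
  calc ∑ i, setIntegralFunctional μ (A i) ((hLi i).toL1 (L i)) = ∫ x, ⨅ i, L i x ∂μ := by
        simp only [setIntegralFunctional_toL1, hA.sum_setIntegral_eq_integral_iInf hL hLi hmin]
    _ = ∑ i, Λ i ((integrable_iInf hL hLi).toL1 _) := (sum_apply_toL1_iInf hL hLi hΛ).symm
    _ ≤ ∑ i, Λ i ((hLi i).toL1 (L i)) :=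
        Finset.sum_le_sum fun i _ => apply_toL1_iInf_le hL hLi hΛ i

lemma apply_indicatorL1_eq_zero_of_isMinOn [IsFiniteMeasure μ] (hL : ∀ i, Measurable (L i))
    (hLi : ∀ i, Integrable (L i) μ) {Λ : ι → WeakDual ℝ (X →₁[μ] ℝ)}
    (hΛ : Λ ∈ fractionalPartitions μ ι)
    (hmin : IsMinOn (fun Λ => ∑ i, Λ i ((hLi i).toL1 (L i))) (fractionalPartitions μ ι) Λ)
    {i : ι} {E : Set X} (hE : MeasurableSet E) (hiE : ∀ x ∈ E, i ∉ argminSet fun j => L j x) :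
    Λ i (indicatorL1 μ hE) = 0 := by
  have henv := integrable_iInf hL hLi
  have hle (x : X) : ⨅ j, L j x ≤ L i x := ciInf_le (finite_range fun j => L j x).bddBelow i
  let _ : MeasurableSpace ι := ⊤
  obtain ⟨σ, hσ, hσmin⟩ := exists_measurable_argmin hL
  have hσ_part : IsAEPartition μ fun i => σ ⁻¹' {i} := isAEPartition_fiber hσ
  have hsum : ∑ j, Λ j ((hLi j).toL1 (L j)) ≤ ∑ j, Λ j (henv.toL1 _) := by
    calc ∑ j, Λ j ((hLi j).toL1 (L j))
        ≤ ∑ j, setIntegralFunctional μ (σ ⁻¹' {j}) ((hLi j).toL1 (L j)) :=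
          hmin hσ_part.setIntegralFunctional_mem
      _ = ∫ x, ⨅ j, L j x ∂μ := by
          simp only [setIntegralFunctional_toL1]
          exact hσ_part.sum_setIntegral_eq_integral_iInf hL hLi fun j x hx => hx ▸ hσmin x
      _ = ∑ j, Λ j (henv.toL1 _) := (sum_apply_toL1_iInf hL hLi hΛ).symm
  have hzero : Λ i (henv.toL1 _) = Λ i ((hLi i).toL1 (L i)) :=
    (Finset.sum_eq_sum_iff_of_le fun j _ => apply_toL1_iInf_le hL hLi hΛ j).1
      (hsum.antisymm' (Finset.sum_le_sum fun j _ => apply_toL1_iInf_le hL hLi hΛ j)) i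
      (Finset.mem_univ i)
  refine apply_indicatorL1_eq_zero_of_pos hΛ (h := fun x => L i x - ⨅ j, L j x)
    ((hL i).sub (Measurable.iInf hL)) ((hLi i).sub henv) (fun x => sub_nonneg.2 (hle x)) ?_ hE
    fun x hx => sub_pos.2 ((hle x).lt_of_ne fun h => hiE x hx (ciInf_eq_iff_mem_argminSet.1 h))
  exact (congrArg (Λ i) (Integrable.toL1_sub _ _ (hLi i) henv)).trans
    ((map_sub _ _ _).trans (sub_eq_zero.2 hzero.symm))

end LowerEnvelope

section Nonatomic

lemma continuous_measureReal_Iic (ν : Measure ℝ) [IsFiniteMeasure ν] [NullSingletonClass ν] :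
    Continuous fun t => ν.real (Iic t) := by
  refine continuous_iff_continuousAt.2 fun t => ?_
  have hprimitive := IntegrableOn.continuousOn_Iic_primitive_Iic (μ := ν) (f := fun _ => (1 : ℝ))
    (a₀ := t + 1) (integrable_const (1 : ℝ)).integrableOn
  simpa using hprimitive.continuousAt (Iic_mem_nhds (lt_add_one t))

lemma tendsto_measureReal_Iic_atTop (ν : Measure ℝ) [IsFiniteMeasure ν] :
    Tendsto (fun t => ν.real (Iic t)) atTop (𝓝 (ν.real univ)) :=
  (ENNReal.tendsto_toReal (measure_ne_top ν univ)).comp (tendsto_measure_Iic_atTop ν)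

lemma tendsto_measureReal_Iic_atBot (ν : Measure ℝ) [IsFiniteMeasure ν] :
    Tendsto (fun t => ν.real (Iic t)) atBot (𝓝 0) := by
  have h := (ENNReal.tendsto_toReal (measure_ne_top ν _)).comp <| tendsto_measure_iInter_atBot
    (μ := ν) (fun t : ℝ => measurableSet_Iic.nullMeasurableSet) monotone_Iic ⟨0, measure_ne_top ν _⟩
  rwa [iInter_Iic_eq_empty_iff.2 (by simp [not_bddBelow_univ]), measure_empty] at h

lemma exists_measureReal_Iic_eq (ν : Measure ℝ) [IsFiniteMeasure ν] [NullSingletonClass ν] {m : ℝ}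
    (hm0 : 0 < m) (hm : m < ν.real univ) : ∃ t, ν.real (Iic t) = m :=
  mem_range_of_exists_le_of_exists_ge (continuous_measureReal_Iic ν)
    (((tendsto_measureReal_Iic_atBot ν).eventually_lt_const hm0).exists.imp fun _ => le_of_lt)
    (((tendsto_measureReal_Iic_atTop ν).eventually_const_lt hm).exists.imp fun _ => le_of_lt)

variable {X : Type*} [MeasurableSpace X] [StandardBorelSpace X]

/-- Sierpiński's intermediate value theorem for a nonatomic measure, by transport to the line. -/
lemma exists_measurableSet_subset_measureReal_eq (μ : Measure X) [IsFiniteMeasure μ]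
    [NullSingletonClass μ] {E : Set X} (hE : MeasurableSet E) {m : ℝ} (hm0 : 0 ≤ m)
    (hm : m ≤ μ.real E) : ∃ B ⊆ E, MeasurableSet B ∧ μ.real B = m := by
  rcases hm0.eq_or_lt with rfl | hm0
  · exact ⟨∅, empty_subset _, .empty, measureReal_empty⟩
  rcases hm.eq_or_lt with rfl | hm
  · exact ⟨E, Subset.rfl, hE, rfl⟩
  have hq := measurableEmbedding_embeddingReal X
  set ν : Measure ℝ := (μ.restrict E).map (embeddingReal X) with hν
  have hν_real {s : Set ℝ} (hs : MeasurableSet s) :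
      ν.real s = μ.real (E ∩ embeddingReal X ⁻¹' s) := by
    rw [map_measureReal_apply hq.measurable hs, measureReal_restrict_apply (hq.measurable hs),
      inter_comm]
  have : NullSingletonClass ν := ⟨fun t => by
    rw [hν, hq.map_apply]
    exact (subsingleton_singleton.preimage hq.injective).measure_zero _⟩
  obtain ⟨t, ht⟩ := exists_measureReal_Iic_eq ν hm0 (by simpa [hν_real MeasurableSet.univ] using hm)
  exact ⟨E ∩ embeddingReal X ⁻¹' Iic t, inter_subset_left,
    hE.inter (hq.measurable measurableSet_Iic), hν_real measurableSet_Iic ▸ ht⟩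

variable {ι : Type*} [MeasurableSpace ι]

lemma exists_measurable_split (μ : Measure X) [IsFiniteMeasure μ] [NullSingletonClass μ]
    {S : Finset ι} (hS : S.Nonempty) {E : Set X} (hE : MeasurableSet E) {m : ι → ℝ}
    (hm0 : ∀ i ∈ S, 0 ≤ m i) (hm : ∑ i ∈ S, m i = μ.real E) :
    ∃ τ : X → ι, Measurable τ ∧ (∀ x, τ x ∈ S) ∧ ∀ i ∈ S, μ.real (E ∩ τ ⁻¹' {i}) = m i := by
  classical
  induction hS using Finset.Nonempty.cons_induction generalizing E with
  | singleton a =>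
    refine ⟨fun _ => a, measurable_const, fun _ => Finset.mem_singleton_self a, fun i hi => ?_⟩
    obtain rfl := Finset.mem_singleton.1 hi
    rw [preimage_const_of_mem (mem_singleton i), inter_univ, ← hm, Finset.sum_singleton]
  | cons a S ha _ ih =>
    rw [Finset.sum_cons] at hm
    have hm0' : ∀ i ∈ S, 0 ≤ m i := fun i hi => hm0 i (Finset.mem_cons_of_mem hi)
    obtain ⟨B, hBE, hB, hBm⟩ := exists_measurableSet_subset_measureReal_eq μ hE
      (hm0 a (Finset.mem_cons_self a S)) (by linarith [Finset.sum_nonneg hm0'])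
    obtain ⟨τ, hτ, hτS, hτm⟩ := ih (hE.diff hB) hm0' (by rw [measureReal_sdiff hBE hB]; linarith)
    have hτ_ne (x : X) : τ x ≠ a := fun h => ha (h ▸ hτS x)
    refine ⟨fun x => if x ∈ B then a else τ x, Measurable.ite hB measurable_const hτ,
      fun x => ?_, fun i hi => ?_⟩
    · by_cases hx : x ∈ B
      · simp [hx]
      · simpa [hx] using Or.inr (hτS x)
    rcases Finset.mem_cons.1 hi with rfl | hiS
    · rw [← hBm]
      congr 1 with x
      by_cases hx : x ∈ B
      · simp [hx, hBE hx]
      · simp [hx, hτ_ne x]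
    · rw [← hτm i hiS]
      congr 1 with x
      by_cases hx : x ∈ B
      · simp [hx, show a ≠ i from fun h => ha (h ▸ hiS)]
      · simp [hx]

/-- Purification: fractional weights are replaced by a selection without changing the masses, which
is where the absence of atoms enters. -/
lemma exists_measurable_selection_measureReal_eq [Fintype ι] [Nonempty ι]
    [MeasurableSingletonClass ι] (μ : Measure X) [IsFiniteMeasure μ] [NullSingletonClass μ]
    {A : X → Finset ι} (hA_nonempty : ∀ x, (A x).Nonempty)
    (hA : ∀ S, MeasurableSet (A ⁻¹' {S})) {m : Finset ι → ι → ℝ} (hm0 : ∀ S i, 0 ≤ m S i)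
    (hm_support : ∀ S, ∀ i ∉ S, m S i = 0) (hm : ∀ S, ∑ i, m S i = μ.real (A ⁻¹' {S})) :
    ∃ σ : X → ι, Measurable σ ∧ (∀ x, σ x ∈ A x) ∧
      ∀ i, μ.real (σ ⁻¹' {i}) = ∑ S, m S i := by
  have hsplit (S : Finset ι) : ∃ τ : X → ι, Measurable τ ∧ (S.Nonempty → ∀ x, τ x ∈ S) ∧
      ∀ i, μ.real (A ⁻¹' {S} ∩ τ ⁻¹' {i}) = m S i := by
    rcases S.eq_empty_or_nonempty with rfl | hS
    · have hA_empty : A ⁻¹' {∅} = ∅ :=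
        eq_empty_of_forall_notMem fun x hx => (hA_nonempty x).ne_empty hx
      exact ⟨fun _ => Classical.arbitrary ι, measurable_const, fun h => absurd h (by simp),
        fun i => by simp [hA_empty, hm_support ∅ i]⟩
    obtain ⟨τ, hτ, hτS, hτm⟩ := exists_measurable_split μ hS (hA S) (fun i _ => hm0 S i)
      ((Finset.sum_subset (Finset.subset_univ S) fun i _ hi => hm_support S i hi).trans (hm S))
    refine ⟨τ, hτ, fun _ => hτS, fun i => ?_⟩
    by_cases hi : i ∈ S
    · exact hτm i hi
    have hfiber : τ ⁻¹' {i} = ∅ := eq_empty_of_forall_notMem fun x hx => hi (hx ▸ hτS x)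
    rw [hfiber, inter_empty, measureReal_empty, hm_support S i hi]
  choose τ hτ hτS hτm using hsplit
  refine ⟨fun x => τ (A x) x, measurable_glue hA hτ, fun x => hτS _ (hA_nonempty x) x, fun i => ?_⟩
  rw [measureReal_glue_preimage hA hτ (measurableSet_singleton i)]
  simp only [hτm]

end Nonatomic

section Equilibrium

variable {X ι : Type*} [MeasurableSpace X] [Fintype ι] {μ : Measure X}
  [IsFiniteMeasure μ] {f : ι → X → ℝ} {G : ι → ℝ → ℝ}

lemma exists_isMinOn_relaxedCost [Nonempty ι] {f : ι → X →₁[μ] ℝ}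
    (hG : ∀ i, ContinuousOn (G i) (Icc 0 (μ.real univ))) :
    ∃ Λ ∈ fractionalPartitions μ ι, IsMinOn (relaxedCost f G) (fractionalPartitions μ ι) Λ :=
  isCompact_fractionalPartitions.exists_isMinOn nonempty_fractionalPartitions
    (continuousOn_relaxedCost hG)

theorem exists_measurable_equilibrium [Nonempty ι] [MeasurableSpace ι]
    [MeasurableSingletonClass ι] [StandardBorelSpace X] [NullSingletonClass μ]
    (hf : ∀ i, Measurable (f i)) (hfi : ∀ i, Integrable (f i) μ) {g : ι → ℝ → ℝ}
    (hG : ∀ i, ∀ t ∈ Icc 0 (μ.real univ),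
      HasDerivWithinAt (G i) (g i t) (Icc 0 (μ.real univ)) t) :
    ∃ σ : X → ι, Measurable σ ∧
      ∀ x, σ x ∈ argminSet fun i => f i x + g i (μ.real (σ ⁻¹' {i})) := by
  obtain ⟨Λ, hΛ, hmin⟩ := exists_isMinOn_relaxedCost (f := fun i => (hfi i).toL1 (f i))
    fun i t ht => (hG i t ht).continuousWithinAt
  set N : ι → ℝ := fun i => Λ i (indicatorL1 μ MeasurableSet.univ)
  have hL (i : ι) : Measurable fun x => f i x + g i (N i) := (hf i).add_const _
  have hLi (i : ι) : Integrable (fun x => f i x + g i (N i)) μ := (hfi i).add (integrable_const _)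
  have hlin : IsMinOn (fun Λ => ∑ i, Λ i ((hLi i).toL1 _)) (fractionalPartitions μ ι) Λ := by
    have h := isMinOn_linearization_of_isMinOn_relaxedCost hΛ hmin fun i =>
      hG i _ (apply_indicatorL1_univ_mem_Icc hΛ i)
    simpa only [← toL1_add_const] using h
  have hA := measurableSet_argminSet_fiber hL
  obtain ⟨σ, hσ, hσA, hσm⟩ := exists_measurable_selection_measureReal_eq μ
    (fun x => argminSet_nonempty fun i => f i x + g i (N i)) hA
    (m := fun S i => Λ i (indicatorL1 μ (hA S))) (fun S i => hΛ.1 i _ (indicatorL1_nonneg _))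
    (fun S i hi => apply_indicatorL1_eq_zero_of_isMinOn hL hLi hΛ hlin (hA S)
      fun x (hx : argminSet _ = S) => hx ▸ hi)
    fun S => sum_apply_indicatorL1 hΛ (hA S)
  have hN (i : ι) : μ.real (σ ⁻¹' {i}) = N i := by
    rw [hσm, ← map_sum, sum_indicatorL1_fiber hA]
  exact ⟨σ, hσ, by simpa only [hN] using hσA⟩

/-- The cost of a partition `A`: the points of `A i` pay `f i`, and index `i` is charged `G i` for
the total mass of `A i`. -/
noncomputable def partitionCost (μ : Measure X) (f : ι → X → ℝ) (G : ι → ℝ → ℝ) (A : ι → Set X) :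
    ℝ :=
  ∑ i, ((∫ x in A i, f i x ∂μ) + G i (μ.real (A i)))

lemma relaxedCost_setIntegralFunctional (hfi : ∀ i, Integrable (f i) μ) (A : ι → Set X) :
    relaxedCost (fun i => (hfi i).toL1 (f i)) G (fun i => setIntegralFunctional μ (A i))
      = partitionCost μ f G A := by
  simp only [relaxedCost, partitionCost, setIntegralFunctional_toL1,
    setIntegralFunctional_indicatorL1_univ]

theorem IsAEPartition.partitionCost_le [Nonempty ι] {A D : ι → Set X} (hA : IsAEPartition μ A)
    (hD : IsAEPartition μ D) (hf : ∀ i, Measurable (f i)) (hfi : ∀ i, Integrable (f i) μ)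
    {v : ι → ℝ} (hmin : ∀ i, ∀ x ∈ A i, i ∈ argminSet fun j => f j x + v j)
    (hv : ∀ i, ∀ t ∈ Icc 0 (μ.real univ),
      G i (μ.real (A i)) + v i * (t - μ.real (A i)) ≤ G i t) :
    partitionCost μ f G A ≤ partitionCost μ f G D := by
  have hlin := hA.isMinOn_sum_apply_toL1 (fun i => (hf i).add_const (v i))
    (fun i => (hfi i).add (integrable_const (v i))) hmin
  simp only [fun i => toL1_add_const (hfi i) (v i)] at hlin
  have hrelaxed := isMinOn_iff.1 (isMinOn_relaxedCost_of_isMinOn_linearization (G := G) hlin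
    (by simpa only [setIntegralFunctional_indicatorL1_univ] using hv)) _
    hD.setIntegralFunctional_mem
  simpa only [relaxedCost_setIntegralFunctional] using hrelaxed

end Equilibrium

section NullPreimages

open Module

lemma measure_inter_preimage_eq_zero_of_hasStrictFDerivAt {E : Type*} [NormedAddCommGroup E]
    [NormedSpace ℝ E] [FiniteDimensional ℝ E] [MeasurableSpace E] [BorelSpace E] (μ : Measure E)
    [μ.IsAddHaarMeasure] {f : E → E} {f' : E → E ≃L[ℝ] E} {U N : Set E}
    (hf : ∀ x ∈ U, HasStrictFDerivAt f (f' x : E →L[ℝ] E) x) (hN : μ N = 0) :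
    μ (U ∩ f ⁻¹' N) = 0 := by
  have : CompleteSpace E := FiniteDimensional.complete ℝ E
  refine measure_null_of_locally_null _ fun x hx => ?_
  set e := (hf x hx.1).toOpenPartialHomeomorph f
  have hsource : e.source ∈ 𝓝 x :=
    e.open_source.mem_nhds (hf x hx.1).mem_toOpenPartialHomeomorph_source
  refine ⟨_, inter_mem (mem_nhdsWithin_of_mem_nhds hsource) self_mem_nhdsWithin, ?_⟩
  set V := e '' (e.source ∩ (U ∩ f ⁻¹' N))
  have hV_null : μ V = 0 := measure_mono_null (image_subset_iff.2 fun y hy => hy.2.2) hN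
  have hV_diff : DifferentiableOn ℝ e.symm V := by
    rintro _ ⟨y, hy, rfl⟩
    refine (e.hasFDerivAt_symm (f' := f' y) (e.map_source hy.1)
      ?_).differentiableAt.differentiableWithinAt
    rw [e.left_inv hy.1]
    exact (hf y hy.2.1).hasFDerivAt
  refine measure_mono_null (fun y hy => ?_)
    (addHaar_image_eq_zero_of_differentiableOn_of_addHaar_eq_zero μ hV_diff hV_null)
  exact ⟨e y, mem_image_of_mem e hy, e.left_inv hy.1⟩

variable {ι : Type*}

lemma linearIndependent_sub_of_notMem_affineSpan [Finite ι] {𝕜 E : Type*} [Field 𝕜] [AddCommGroup E]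
    [Module 𝕜 E] {p : ι → E} (hp : AffineIndependent 𝕜 p) {x : E}
    (hx : x ∉ affineSpan 𝕜 (range p)) : LinearIndependent 𝕜 fun i => x - p i := by
  cases nonempty_fintype ι
  refine Fintype.linearIndependent_iff.2 fun w hw => ?_
  simp only [smul_sub, Finset.sum_sub_distrib, ← Finset.sum_smul, sub_eq_zero] at hw
  have hsum : ∑ i, w i = 0 := by
    by_contra hne
    have hweights : ∑ i, (∑ j, w j)⁻¹ * w i = 1 := by rw [← Finset.mul_sum, inv_mul_cancel₀ hne]
    refine hx ?_
    convert affineCombination_mem_affineSpan hweights p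
    rw [Finset.affineCombination_eq_linear_combination _ _ _ hweights]
    simp only [mul_smul, ← Finset.smul_sum, ← hw, inv_smul_smul₀ hne]
  rw [hsum, zero_smul] at hw
  exact fun i => hp.eq_zero_of_sum_eq_zero hsum hw.symm i (Finset.mem_univ i)

lemma hasStrictFDerivAt_dist_left {E : Type*} [NormedAddCommGroup E] [InnerProductSpace ℝ E]
    {x a : E} (hx : x ≠ a) :
    HasStrictFDerivAt (fun y => dist y a) ((dist x a)⁻¹ • innerSL ℝ (x - a)) x := by
  have hsq : HasStrictFDerivAt (fun y => ‖y - a‖ ^ 2) (2 • innerSL ℝ (x - a)) x :=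
    (hasStrictFDerivAt_norm_sq (x - a)).comp x (hasStrictFDerivAt_sub_const a)
  have hsqrt := hsq.sqrt (pow_ne_zero 2 (norm_ne_zero_iff.2 (sub_ne_zero.2 hx)))
  simp only [← dist_eq_norm, Real.sqrt_sq dist_nonneg] at hsqrt
  refine hsqrt.congr_fderiv ?_
  ext h
  simp
  ring

variable [Fintype ι]

lemma exists_hasStrictFDerivAt_dist_of_notMem_affineSpan {p : ι → EuclideanSpace ℝ ι}
    (hp : AffineIndependent ℝ p) {x : EuclideanSpace ℝ ι} (hx : x ∉ affineSpan ℝ (range p)) :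
    ∃ f' : EuclideanSpace ℝ ι ≃L[ℝ] EuclideanSpace ℝ ι,
      HasStrictFDerivAt (fun y => WithLp.toLp 2 fun i => dist y (p i))
        (f' : EuclideanSpace ℝ ι →L[ℝ] EuclideanSpace ℝ ι) x := by
  have hne (i : ι) : x ≠ p i := fun h => hx (h ▸ mem_affineSpan ℝ (mem_range_self i))
  set A : EuclideanSpace ℝ ι →L[ℝ] EuclideanSpace ℝ ι :=
    (EuclideanSpace.equiv ι ℝ).symm.toContinuousLinearMap ∘L
      ContinuousLinearMap.pi fun i => (dist x (p i))⁻¹ • innerSL ℝ (x - p i) with hA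
  have hli := linearIndependent_sub_of_notMem_affineSpan hp hx
  have hspan : ⊤ ≤ Submodule.span ℝ (range fun i => x - p i) :=
    (hli.span_eq_top_of_card_eq_finrank' finrank_euclideanSpace.symm).ge
  have hA_inj : Function.Injective A := by
    refine (injective_iff_map_eq_zero A).2 fun h hAh => ?_
    refine InnerProductSpace.ext_inner_left_basis (Basis.mk hli hspan) fun i => ?_
    have hi := congrArg (· i) hAh
    simpa [hA, inner_sub_left, sub_eq_zero, dist_ne_zero.2 (hne i)] using hi
  exact ⟨(LinearEquiv.ofInjectiveEndo A.toLinearMap hA_inj).toContinuousLinearEquiv,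
    hasStrictFDerivAt_euclidean.2 fun i => hasStrictFDerivAt_dist_left (hne i)⟩

lemma volume_dist_preimage_eq_zero {p : ι → EuclideanSpace ℝ ι} (hp : AffineIndependent ℝ p)
    {N : Set (EuclideanSpace ℝ ι)} (hN : volume N = 0) :
    volume ((fun x => WithLp.toLp 2 fun i => dist x (p i)) ⁻¹' N) = 0 := by
  choose! f' hf' using fun x (hx : x ∉ affineSpan ℝ (range p)) =>
    exists_hasStrictFDerivAt_dist_of_notMem_affineSpan hp hx
  have hspan : volume (affineSpan ℝ (range p) : Set (EuclideanSpace ℝ ι)) = 0 := by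
    refine Measure.addHaar_affineSubspace _ _ fun h => ?_
    have hcard := hp.affineSpan_eq_top_iff_card_eq_finrank_add_one.1 h
    rw [finrank_euclideanSpace] at hcard
    exact (Nat.lt_succ_self _).ne hcard
  refine measure_mono_null (fun x hx => ?_) (measure_union_null hspan
    (measure_inter_preimage_eq_zero_of_hasStrictFDerivAt volume hf' hN))
  by_cases h : x ∈ affineSpan ℝ (range p)
  exacts [.inl h, .inr ⟨h, hx⟩]

end NullPreimages

section Ties

variable {X Y β : Type*} [MeasurableSpace X] [MeasurableSpace Y] [MeasurableSpace β]

lemma measurable_comp_of_measurable_domRestrict {f : Y → β} {s : Set Y}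
    (hf : Measurable (s.domRestrict f)) {g : X → Y} (hg : Measurable g) (hgs : ∀ x, g x ∈ s) :
    Measurable fun x => f (g x) :=
  hf.comp (hg.subtype_mk (h := hgs))

lemma measure_prod_eqLocus_eq_zero [MeasurableEq β] {μ : Measure X} {ν : Measure Y} [SFinite ν]
    {f : X → β} {g : Y → β} (hf : Measurable f) (hg : Measurable g)
    (hlevel : ∀ c, ν {y | g y = c} = 0) : (μ.prod ν) {z | f z.1 = g z.2} = 0 := by
  have hm : MeasurableSet {z : X × Y | f z.1 = g z.2} :=
    measurableSet_eq_fun (hf.comp measurable_fst) (hg.comp measurable_snd)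
  rw [Measure.measure_prod_null hm]
  refine Eventually.of_forall fun x => ?_
  have h : {y | g y = f x} = Prod.mk x ⁻¹' {z : X × Y | f z.1 = g z.2} := by ext; exact eq_comm
  exact (congrArg ν h).symm.trans (hlevel (f x))

lemma measurePreserving_coordinates :
    MeasurePreserving (fun y : Plane => (y 0, y 1)) volume volume :=
  (volume_preserving_finTwoArrow ℝ).comp
    (EuclideanSpace.volume_preserving_symm_measurableEquiv_toLp (Fin 2))

variable {F : ℝ → ℝ}

lemma volume_radii_eq_add_eq_zero (hF : Measurable ((Ici 0).domRestrict F))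
    (hlevel : ∀ c, volume {r : ℝ | 0 ≤ r ∧ F r = c} = 0) (c : ℝ) :
    volume {y : Plane | 0 ≤ y 0 ∧ 0 ≤ y 1 ∧ F (y 0) = F (y 1) + c} = 0 := by
  set H : ℝ → ℝ := fun r => F (max r 0)
  have hH : Measurable H :=
    measurable_comp_of_measurable_domRestrict hF (by fun_prop) fun r => le_max_right r 0
  have hHF (r : ℝ) (hr : 0 ≤ r) : H r = F r := congrArg F (max_eq_left hr)
  have hH_level (b : ℝ) : volume.restrict (Ici 0) {r | H r + c = b} = 0 := by
    rw [Measure.restrict_apply (measurableSet_eq_fun (hH.add_const c) measurable_const)]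
    refine measure_mono_null ?_ (hlevel (b - c))
    exact fun r ⟨hrb, hr⟩ => ⟨hr, hHF r hr ▸ eq_sub_of_add_eq hrb⟩
  have hprod : (volume.restrict (Ici 0 ×ˢ Ici 0)) {z : ℝ × ℝ | H z.1 = H z.2 + c} = 0 := by
    rw [Measure.volume_eq_prod, ← Measure.prod_restrict]
    exact measure_prod_eqLocus_eq_zero hH (hH.add_const c) hH_level
  have hnull := nonpos_iff_eq_zero.1 ((Measure.le_restrict_apply _ _).trans_eq hprod)
  refine measure_mono_null (fun y hy => ?_)
    (measurePreserving_coordinates.quasiMeasurePreserving.preimage_null hnull)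
  exact ⟨by simpa only [mem_ofPred_eq, hHF _ hy.1, hHF _ hy.2.1] using hy.2.2, hy.1, hy.2.1⟩

lemma volume_tie_eq_zero (hF : Measurable ((Ici 0).domRestrict F))
    (hlevel : ∀ c, volume {r : ℝ | 0 ≤ r ∧ F r = c} = 0) {a b : Plane} (hab : a ≠ b) (c : ℝ) :
    volume {x : Plane | F (dist x a) = F (dist x b) + c} = 0 :=
  measure_mono_null (fun x hx => by simpa using hx) (volume_dist_preimage_eq_zero
    (affineIndependent_of_ne ℝ hab) (volume_radii_eq_add_eq_zero hF hlevel c))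

end Ties

section DensityMeasure

variable {X : Type*} [MeasurableSpace X]

/-- The measure with density `lam` with respect to `ν` on the set `Ω`, and with no mass outside
`Ω`. Negative values of `lam` are truncated to `0`. -/
noncomputable def densityMeasure (ν : Measure X) (Ω : Set X) (lam : X → ℝ) : Measure X :=
  (ν.restrict Ω).withDensity fun x => ENNReal.ofReal (lam x)

variable {ν : Measure X} {Ω A : Set X} {lam g : X → ℝ}

lemma densityMeasure_absolutelyContinuous : densityMeasure ν Ω lam ≪ ν :=
  (withDensity_absolutelyContinuous _ _).trans Measure.restrict_le_self.absolutelyContinuous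

lemma densityMeasure_compl (hΩ : MeasurableSet Ω) : densityMeasure ν Ω lam Ωᶜ = 0 :=
  withDensity_absolutelyContinuous _ _ (by simp [Measure.restrict_apply hΩ.compl])

lemma isFiniteMeasure_densityMeasure (hint : IntegrableOn lam Ω ν) :
    IsFiniteMeasure (densityMeasure ν Ω lam) :=
  isFiniteMeasure_withDensity_ofReal hint.2

lemma nullSingletonClass_densityMeasure [NullSingletonClass ν] :
    NullSingletonClass (densityMeasure ν Ω lam) :=
  ⟨fun x => densityMeasure_absolutelyContinuous (measure_singleton x)⟩

lemma setIntegral_densityMeasure (hnonneg : ∀ x ∈ Ω, 0 ≤ lam x) (hint : IntegrableOn lam Ω ν)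
    (g : X → ℝ) (hA : MeasurableSet A) (hAΩ : A ⊆ Ω) :
    ∫ x in A, g x ∂densityMeasure ν Ω lam = ∫ x in A, g x * lam x ∂ν := by
  rw [densityMeasure, setIntegral_withDensity_eq_setIntegral_toReal_smul₀
    (hint.1.aemeasurable.ennreal_ofReal.mono_measure Measure.restrict_le_self)
    (Eventually.of_forall fun x => ENNReal.ofReal_lt_top) g hA,
    Measure.restrict_restrict_of_subset hAΩ]
  refine setIntegral_congr_fun hA fun x hx => ?_
  simp only [ENNReal.toReal_ofReal (hnonneg x (hAΩ hx)), smul_eq_mul, mul_comm]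

lemma measureReal_densityMeasure (hnonneg : ∀ x ∈ Ω, 0 ≤ lam x) (hint : IntegrableOn lam Ω ν)
    (hA : MeasurableSet A) (hAΩ : A ⊆ Ω) :
    (densityMeasure ν Ω lam).real A = ∫ x in A, lam x ∂ν := by
  simpa using setIntegral_densityMeasure hnonneg hint (fun _ => 1) hA hAΩ

lemma measureReal_inter_densityMeasure (hΩ : MeasurableSet Ω) (A : Set X) :
    (densityMeasure ν Ω lam).real (Ω ∩ A) = (densityMeasure ν Ω lam).real A := by
  rw [measureReal_def, measureReal_def, inter_comm, measure_inter_conull (densityMeasure_compl hΩ)]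

lemma integrable_densityMeasure (hΩ : MeasurableSet Ω) (hnonneg : ∀ x ∈ Ω, 0 ≤ lam x)
    (hint : IntegrableOn lam Ω ν) (hg : IntegrableOn (fun x => g x * lam x) Ω ν) :
    Integrable g (densityMeasure ν Ω lam) := by
  rw [densityMeasure, integrable_withDensity_iff_integrable_smul₀'
    hint.1.aemeasurable.ennreal_ofReal (Eventually.of_forall fun x => ENNReal.ofReal_lt_top)]
  refine (integrableOn_congr_fun (fun x hx => ?_) hΩ).1 hg
  simp only [ENNReal.toReal_ofReal (hnonneg x hx), smul_eq_mul, mul_comm]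

end DensityMeasure

section Convexity

lemma add_mul_sub_le_of_convexOn {S : Set ℝ} {φ : ℝ → ℝ} (hφ : ConvexOn ℝ S φ) {a b d : ℝ}
    (ha : a ∈ S) (hb : b ∈ S) (hd : HasDerivWithinAt φ d S a) : φ a + d * (b - a) ≤ φ b := by
  rcases lt_trichotomy a b with hab | rfl | hba
  · have h := hφ.le_slope_of_hasDerivWithinAt ha hb hab hd
    rw [slope_def_field, le_div_iff₀ (sub_pos.2 hab)] at h
    linarith
  · simp
  · have h := hφ.slope_le_of_hasDerivWithinAt hb ha hba hd
    rw [slope_def_field, div_le_iff₀ (sub_pos.2 hba)] at h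
    linarith

lemma convexOn_id_mul_of_monotoneOn {S : Set ℝ} {s : ℝ → ℝ} (hS : S ⊆ Ici 0) (h0 : 0 ∈ S)
    (hmono : MonotoneOn s S) (hconv : ConvexOn ℝ S s) : ConvexOn ℝ S fun t => t * s t := by
  have hnonneg {t : ℝ} (ht : t ∈ S) : s 0 ≤ s t := hmono h0 ht (hS ht)
  have hmul : ConvexOn ℝ S fun t => t * (s t + -s 0) :=
    (convexOn_id hconv.1).mul (hconv.add_const (-s 0)) (fun t ht => hS ht)
      (fun t ht => by simpa using hnonneg ht)
      (monotoneOn_id.monovaryOn (hmono.add_const (-s 0)))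
  have hlin : ConvexOn ℝ S fun t => t * s 0 := (LinearMap.mulRight ℝ (s 0)).convexOn hconv.1
  exact (hmul.add hlin).congr fun t _ => by simp only [Pi.add_apply]; ring

/-- The derivative of the total congestion cost `t * s t` of a cell of mass `t`, one-sided at the
end points of `[0, 1]`. -/
noncomputable def marginalCost (s : ℝ → ℝ) (t : ℝ) : ℝ :=
  s t + t * derivWithin s (Icc 0 1) t

lemma hasDerivWithinAt_marginalCost {s : ℝ → ℝ} (hs : DifferentiableOn ℝ s (Icc 0 1)) {t : ℝ}
    (ht : t ∈ Icc (0 : ℝ) 1) :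
    HasDerivWithinAt (fun t => t * s t) (marginalCost s t) (Icc 0 1) t := by
  simpa [marginalCost] using (hasDerivWithinAt_id t (Icc 0 1)).fun_mul (hs t ht).hasDerivWithinAt

end Convexity

section CellPartitions

variable {K : ℕ} {Ω : Set Plane} {lam : Plane → ℝ} {p : Fin K → Plane} {F : ℝ → ℝ}
  {s : Fin K → ℝ → ℝ} {N : Fin K → ℝ} {C : Fin K → Set Plane}

lemma level_eq_add_marginalCost (i : Fin K) (x : Plane) :
    level p F s N i x = F (dist x (p i)) + marginalCost (s i) (N i) :=
  add_assoc ..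

lemma mem_minCell_iff {i : Fin K} {x : Plane} :
    x ∈ minCell Ω p F s N i ↔
      x ∈ Ω ∧ i ∈ argminSet fun j => F (dist x (p j)) + marginalCost (s j) (N j) := by
  simp only [minCell, mem_ofPred_eq, mem_argminSet, level_eq_add_marginalCost]

lemma measurable_comp_dist (hF : Measurable ((Ici 0).domRestrict F)) (a : Plane) :
    Measurable fun x : Plane => F (dist x a) :=
  measurable_comp_of_measurable_domRestrict hF (by fun_prop) fun _ => dist_nonneg

lemma measurableSet_minCell (hΩ : MeasurableSet Ω) (hF : Measurable ((Ici 0).domRestrict F))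
    (i : Fin K) : MeasurableSet (minCell Ω p F s N i) := by
  have hm (j : Fin K) : Measurable (level p F s N j) :=
    ((measurable_comp_dist hF (p j)).add_const _).add_const _
  simp only [minCell, ofPred_and, ofPred_forall]
  exact hΩ.inter (.iInter fun j => measurableSet_le (hm i) (hm j))

lemma aedisjoint_minCell (hF : Measurable ((Ici 0).domRestrict F)) (hp : Function.Injective p)
    (hlevel : ∀ c, volume {r : ℝ | 0 ≤ r ∧ F r = c} = 0) :
    Pairwise (Function.onFun (AEDisjoint volume) (minCell Ω p F s N)) := by
  refine fun i j hij => measure_mono_null ?_ (volume_tie_eq_zero hF hlevel (hp.ne hij)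
    (marginalCost (s j) (N j) - marginalCost (s i) (N i)))
  rintro x ⟨hi, hj⟩
  have htie := le_antisymm (hi.2 j) (hj.2 i)
  simp only [level_eq_add_marginalCost] at htie
  rw [mem_ofPred_eq]
  linarith

lemma iUnion_minCell (hcover : ⋃ i, C i = Ω) (hmin : ∀ i, C i ⊆ minCell Ω p F s N i) :
    ⋃ i, minCell Ω p F s N i = Ω :=
  (iUnion_subset fun _ _ hx => hx.1).antisymm (hcover.symm.trans_subset (iUnion_mono hmin))

lemma strictMinCell_subset (hcover : ⋃ i, C i = Ω) (hmin : ∀ i, C i ⊆ minCell Ω p F s N i)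
    (i : Fin K) : strictMinCell Ω p F s N i ⊆ C i := by
  intro x hx
  obtain ⟨j, hj⟩ := mem_iUnion.1 (hcover.symm ▸ hx.1)
  rcases eq_or_ne j i with rfl | hji
  · exact hj
  · exact absurd ((hmin j hj).2 i) (hx.2 j hji).not_ge

lemma IsCellPartition.subset (hC : IsCellPartition Ω lam C) (i : Fin K) : C i ⊆ Ω :=
  hC.cover ▸ subset_iUnion C i

lemma IsCellPartition.isAEPartition (hC : IsCellPartition Ω lam C) (hΩ : MeasurableSet Ω)
    (hnonneg : ∀ x ∈ Ω, 0 ≤ lam x) (hint : IntegrableOn lam Ω) :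
    IsAEPartition (densityMeasure volume Ω lam) C where
  measurableSet := hC.measurable
  aedisjoint i j hij := by
    have := isFiniteMeasure_densityMeasure hint
    have h := hC.overlap i j hij
    rwa [mass, ← measureReal_densityMeasure hnonneg hint
      ((hC.measurable i).inter (hC.measurable j)) (inter_subset_left.trans (hC.subset i)),
      measureReal_eq_zero_iff] at h
  iUnion_ae_eq_univ := by
    rw [hC.cover]
    exact ae_eq_univ.2 (densityMeasure_compl hΩ)

lemma IsCellPartition.mass_eq (hC : IsCellPartition Ω lam C) (hnonneg : ∀ x ∈ Ω, 0 ≤ lam x)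
    (hint : IntegrableOn lam Ω) (i : Fin K) :
    mass lam (C i) = (densityMeasure volume Ω lam).real (C i) :=
  (measureReal_densityMeasure hnonneg hint (hC.measurable i) (hC.subset i)).symm

lemma IsCellPartition.cost_eq_partitionCost (hC : IsCellPartition Ω lam C)
    (hnonneg : ∀ x ∈ Ω, 0 ≤ lam x) (hint : IntegrableOn lam Ω)
    (hfi : ∀ i, Integrable (fun x => F (dist x (p i))) (densityMeasure volume Ω lam)) :
    cost p lam F s C = partitionCost (densityMeasure volume Ω lam)
      (fun i x => F (dist x (p i))) (fun i t => t * s i t) C := by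
  have := isFiniteMeasure_densityMeasure hint
  refine Finset.sum_congr rfl fun i _ => ?_
  rw [← setIntegral_densityMeasure hnonneg hint _ (hC.measurable i) (hC.subset i),
    integral_add (hfi i).integrableOn (integrable_const _), setIntegral_const, smul_eq_mul,
    hC.mass_eq hnonneg hint]

lemma measureReal_univ_densityMeasure_eq_one (hΩ : MeasurableSet Ω)
    (hnonneg : ∀ x ∈ Ω, 0 ≤ lam x) (hint : IntegrableOn lam Ω) (hmass : mass lam Ω = 1) :
    (densityMeasure volume Ω lam).real univ = 1 := by
  rw [← measureReal_inter_densityMeasure hΩ, inter_univ,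
    measureReal_densityMeasure hnonneg hint hΩ Subset.rfl, ← mass, hmass]

theorem IsCellPartition.solvesP1_of_subset_minCell [Nonempty (Fin K)]
    (hC : IsCellPartition Ω lam C) (hΩ : MeasurableSet Ω) (hnonneg : ∀ x ∈ Ω, 0 ≤ lam x)
    (hint : IntegrableOn lam Ω) (hmass : mass lam Ω = 1)
    (hF : Measurable ((Ici 0).domRestrict F))
    (hF_int : ∀ i, IntegrableOn (fun x => F (dist x (p i)) * lam x) Ω)
    (hs_diff : ∀ i, DifferentiableOn ℝ (s i) (Icc 0 1))
    (hs_conv : ∀ i, ConvexOn ℝ (Icc 0 1) fun t => t * s i t)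
    (hmin : ∀ i, C i ⊆ minCell Ω p F s (fun j => mass lam (C j)) i) :
    SolvesP1 Ω p lam F s C := by
  refine ⟨hC, fun D hD => ?_⟩
  have := isFiniteMeasure_densityMeasure hint
  have hfi (i : Fin K) := integrable_densityMeasure hΩ hnonneg hint (hF_int i)
  have huniv := measureReal_univ_densityMeasure_eq_one hΩ hnonneg hint hmass
  rw [hC.cost_eq_partitionCost hnonneg hint hfi, hD.cost_eq_partitionCost hnonneg hint hfi]
  refine (hC.isAEPartition hΩ hnonneg hint).partitionCost_le (hD.isAEPartition hΩ hnonneg hint)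
    (fun i => measurable_comp_dist hF (p i)) hfi
    (fun i x hx => (mem_minCell_iff.1 (hmin i hx)).2) fun i t ht => ?_
  rw [huniv] at ht
  have hN : mass lam (C i) ∈ Icc 0 1 := by
    rw [hC.mass_eq hnonneg hint, ← huniv]
    exact ⟨measureReal_nonneg, measureReal_mono (subset_univ _)⟩
  rw [← hC.mass_eq hnonneg hint]
  exact add_mul_sub_le_of_convexOn (hs_conv i) hN ht
    (hasDerivWithinAt_marginalCost (hs_diff i) hN)

theorem exists_isCellPartition_subset_minCell [Nonempty (Fin K)] (hΩ : MeasurableSet Ω)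
    (hnonneg : ∀ x ∈ Ω, 0 ≤ lam x) (hint : IntegrableOn lam Ω) (hmass : mass lam Ω = 1)
    (hF : Measurable ((Ici 0).domRestrict F))
    (hF_int : ∀ i, IntegrableOn (fun x => F (dist x (p i)) * lam x) Ω)
    (hs_diff : ∀ i, DifferentiableOn ℝ (s i) (Icc 0 1)) :
    ∃ C : Fin K → Set Plane, IsCellPartition Ω lam C ∧ (∀ i j, i ≠ j → Disjoint (C i) (C j)) ∧
      ∀ i, C i ⊆ minCell Ω p F s (fun j => mass lam (C j)) i := by
  have := isFiniteMeasure_densityMeasure hint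
  have : NullSingletonClass (densityMeasure volume Ω lam) := nullSingletonClass_densityMeasure
  obtain ⟨σ, hσ, hσ_min⟩ := exists_measurable_equilibrium
    (fun i => measurable_comp_dist hF (p i))
    (fun i => integrable_densityMeasure hΩ hnonneg hint (hF_int i)) (fun i t ht => by
      rw [measureReal_univ_densityMeasure_eq_one hΩ hnonneg hint hmass] at ht ⊢
      exact hasDerivWithinAt_marginalCost (hs_diff i) ht)
  have hdisj (i j : Fin K) (hij : i ≠ j) : Disjoint (Ω ∩ σ ⁻¹' {i}) (Ω ∩ σ ⁻¹' {j}) :=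
    ((disjoint_singleton.2 hij).preimage σ).mono inter_subset_right inter_subset_right
  have hC : IsCellPartition Ω lam fun i => Ω ∩ σ ⁻¹' {i} :=
    { measurable := fun i => hΩ.inter (hσ (measurableSet_singleton i))
      cover := by
        rw [← inter_iUnion, ← preimage_iUnion, iUnion_of_singleton, preimage_univ, inter_univ]
      overlap := fun i j hij => by simp [mass, (hdisj i j hij).inter_eq] }
  refine ⟨_, hC, hdisj, fun i x ⟨hxΩ, hxi⟩ => mem_minCell_iff.2 ⟨hxΩ, ?_⟩⟩
  simpa only [hC.mass_eq hnonneg hint, measureReal_inter_densityMeasure hΩ,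
    eq_of_mem_singleton hxi] using hσ_min x

lemma IsCellPartition.isCellPartition_minCell (hC : IsCellPartition Ω lam C) (hΩ : MeasurableSet Ω)
    (hF : Measurable ((Ici 0).domRestrict F)) (hp : Function.Injective p)
    (hlevel : ∀ c, volume {r : ℝ | 0 ≤ r ∧ F r = c} = 0)
    (hmin : ∀ i, C i ⊆ minCell Ω p F s N i) :
    IsCellPartition Ω lam (minCell Ω p F s N) where
  measurable := measurableSet_minCell hΩ hF
  cover := iUnion_minCell hC.cover hmin
  overlap _ _ hij := setIntegral_measure_zero _ (aedisjoint_minCell hF hp hlevel hij)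

lemma mass_minCell (hF : Measurable ((Ici 0).domRestrict F)) (hp : Function.Injective p)
    (hlevel : ∀ c, volume {r : ℝ | 0 ≤ r ∧ F r = c} = 0) (hcover : ⋃ i, C i = Ω)
    (hmin : ∀ i, C i ⊆ minCell Ω p F s N i) (i : Fin K) :
    mass lam (minCell Ω p F s N i) = mass lam (C i) :=
  setIntegral_congr_set (ae_eq_of_subset_of_aedisjoint hmin (aedisjoint_minCell hF hp hlevel)
    ((iUnion_minCell hcover hmin).trans hcover.symm).subset i).symm

end CellPartitions

end CellAssociation

open CellAssociation in
theorem mainTheorem1_general {K : ℕ} (hK : 0 < K) {Ω : Set Plane} (hΩ : MeasurableSet Ω)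
    {lam : Plane → ℝ} (hnonneg : ∀ x ∈ Ω, 0 ≤ lam x) (hint : IntegrableOn lam Ω)
    (hmass : mass lam Ω = 1) {p : Fin K → Plane} {F : ℝ → ℝ}
    (hF : Measurable ((Ici 0).domRestrict F))
    (hF_int : ∀ i, IntegrableOn (fun x => F (dist x (p i)) * lam x) Ω) {s : Fin K → ℝ → ℝ}
    (hs_diff : ∀ i, DifferentiableOn ℝ (s i) (Icc 0 1))
    (hs_conv : ∀ i, ConvexOn ℝ (Icc 0 1) fun t => t * s i t) :
    (∃ C : Fin K → Set Plane, SolvesP1 Ω p lam F s C ∧ (∀ i j, i ≠ j → Disjoint (C i) (C j)) ∧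
      ∀ i, strictMinCell Ω p F s (fun j => mass lam (C j)) i ⊆ C i ∧
        C i ⊆ minCell Ω p F s (fun j => mass lam (C j)) i) ∧
    (Function.Injective p → (∀ c, volume {r : ℝ | 0 ≤ r ∧ F r = c} = 0) →
      ∃ C : Fin K → Set Plane, SolvesP1 Ω p lam F s C ∧
        ∀ i, C i = minCell Ω p F s (fun j => mass lam (C j)) i) := by
  have : Nonempty (Fin K) := Fin.pos_iff_nonempty.1 hK
  obtain ⟨C, hC, hdisj, hmin⟩ := exists_isCellPartition_subset_minCell (p := p) (s := s)
    hΩ hnonneg hint hmass hF hF_int hs_diff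
  refine ⟨⟨C, hC.solvesP1_of_subset_minCell hΩ hnonneg hint hmass hF hF_int hs_diff hs_conv hmin,
    hdisj, fun i => ⟨strictMinCell_subset hC.cover hmin i, hmin i⟩⟩, fun hp hlevel => ?_⟩
  have hB := hC.isCellPartition_minCell hΩ hF hp hlevel hmin
  have hmasses := funext (mass_minCell (lam := lam) hF hp hlevel hC.cover hmin)
  exact ⟨_, hB.solvesP1_of_subset_minCell hΩ hnonneg hint hmass hF hF_int hs_diff hs_conv
    fun i => by rw [hmasses], fun i => by rw [hmasses]⟩

theorem mainTheorem1 {K : ℕ} (hK : 0 < K)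
    (Ω : Set CellAssociation.Plane) (hΩ : MeasurableSet Ω)
    (lam : CellAssociation.Plane → ℝ) (hlam_nonneg : ∀ x ∈ Ω, 0 ≤ lam x)
    (hlam_int : MeasureTheory.IntegrableOn lam Ω) (hlam_mass : CellAssociation.mass lam Ω = 1)
    (p : Fin K → CellAssociation.Plane)
    (F : ℝ → ℝ) (hF : ContinuousOn F (Set.Ici 0))
    (hF_int : ∀ i, MeasureTheory.IntegrableOn (fun x => F (dist x (p i)) * lam x) Ω)
    (s : Fin K → ℝ → ℝ)
    (hs_diff : ∀ i, ContDiffOn ℝ 1 (s i) (Set.Icc 0 1))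
    (hs_mono : ∀ i, MonotoneOn (s i) (Set.Icc 0 1))
    (hs_conv : ∀ i, ConvexOn ℝ (Set.Icc 0 1) (s i)) :
    -- For every continuous `F`: a solution of (P1) with pairwise disjoint cells that satisfies
    -- (S1), points where several indices are minimal being given to one of these indices.
    (∃ C : Fin K → Set CellAssociation.Plane,
      CellAssociation.SolvesP1 Ω p lam F s C ∧
      (∀ i j, i ≠ j → Disjoint (C i) (C j)) ∧
      ∀ i,
        CellAssociation.strictMinCell Ω p F s (fun j => CellAssociation.mass lam (C j)) i ⊆ C i ∧
        C i ⊆ CellAssociation.minCell Ω p F s (fun j => CellAssociation.mass lam (C j)) i) ∧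
    -- If the base stations are distinct and the level sets of `F` are null: a solution of (P1)
    -- that satisfies (S1) with equality of sets.
    (Function.Injective p →
      (∀ c : ℝ, MeasureTheory.volume {r : ℝ | 0 ≤ r ∧ F r = c} = 0) →
      ∃ C : Fin K → Set CellAssociation.Plane,
        CellAssociation.SolvesP1 Ω p lam F s C ∧
        ∀ i, C i =
          CellAssociation.minCell Ω p F s (fun j => CellAssociation.mass lam (C j)) i) := by
  exact mainTheorem1_general hK hΩ hlam_nonneg hlam_int hlam_mass
    (continuousOn_iff_continuous_domRestrict.1 hF).measurable hF_int
    (fun i => (hs_diff i).differentiableOn one_ne_zero) fun i =>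
      CellAssociation.convexOn_id_mul_of_monotoneOn Icc_subset_Ici_self (by simp) (hs_mono i)
        (hs_conv i)
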